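/- Let $\mathbb{T}=\mathbb{R}/\mathbb{Z}$ and let $C(\mathbb{T})$ be the space of continuous functions $f:\mathbb{T}\to\mathbb{C}$. A centred complex Gaussian process $X$ is understood to be circularly symmetric, i.e. $\mathbb{E}(X_tX_s)=0$ for all $t,s$, so that its law is determined by the covariances $\mathbb{E}(X_t\overline{X_s})$. For a Borel probability measure $\mu$ on $\mathbb{T}$ and $f\in C(\mathbb{T})$, let $X_f=\{X_f(t):t\in\mathbb{T}\}$ be the centred complex Gaussian process with $$\mathbb{E}\big(X_f(t)\overline{X_f(s)}\big)=\int_{\mathbb{T}} f(t+u)\overline{f(s+u)}\,d\mu(u),\qquad t,s\in\mathbb{T},$$ and let $\mathscr{P}(\mu)$ be the class of all $f\in C(\mathbb{T})$ for which $X_f$ has almost surely bounded paths (that is, has a version with almost surely bounded paths). For $0\le H<1$, the complex fractional Gaussian noise of index $H$ is the centred complex Gaussian sequence $(\Delta_n)_{n\in\mathbb{Z}}$ with $$\mathbb{E}(\Delta_n\overline{\Delta_m})=\gamma_H(n-m),\qquad \gamma_H(k)=\tfrac12|k+1|^{2H}+\tfrac12|k-1|^{2H}-|k|^{2H},$$ where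 $|0|^{2H}$ is read as $0$ also when $H=0$. Its spectral measure is the Borel probability measure $\mu_H$ on $\mathbb{T}$ with $\gamma_H(n-m)=\int_{\mathbb{T}}e^{2\pi i(n-m)t}\,d\mu_H(t)$ for all $n,m\in\mathbb{Z}$. Put $\mathscr{P}(H)=\mathscr{P}(\mu_H)$. Then for any $0\le H_1\le H_2<1$, $$\mathscr{P}(H_2)\subset\mathscr{P}(H_1).$$ -/

import Mathlib

open MeasureTheory ProbabilityTheory
open scoped ComplexConjugate

/-- `X` is a centred, circularly symmetric complex Gaussian process with covariance function `K`:
its finite-dimensional laws are Gaussian, `E X_t = 0`, `E (X_t * conj X_s) = K t s` and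
`E (X_t * X_s) = 0`. These conditions determine the law of `X`. -/
structure IsComplexGaussianProcess {ι Ω : Type} [MeasurableSpace Ω]
    (K : ι → ι → ℂ) (X : ι → Ω → ℂ) (P : Measure Ω) : Prop where
  isGaussian : IsGaussianProcess X P
  mean_eq_zero : ∀ t, ∫ ω, X t ω ∂P = 0
  covariance_eq : ∀ t s, ∫ ω, X t ω * conj (X s ω) ∂P = K t s
  pseudoCovariance_eq_zero : ∀ t s, ∫ ω, X t ω * X s ω ∂P = 0

/-- The covariance function `(t, s) ↦ ∫ f(t + u) conj (f(s + u)) dμ(u)` of the process `X_f`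
attached to a continuous function `f` and a measure `μ` on the circle `ℝ / ℤ`. -/
noncomputable def translateCov (μ : Measure UnitAddCircle) (f : C(UnitAddCircle, ℂ))
    (t s : UnitAddCircle) : ℂ :=
  ∫ u, f (t + u) * conj (f (s + u)) ∂μ

/-- The class `𝒫(μ)`: the continuous functions `f` on the circle whose Gaussian process `X_f` has
almost surely bounded paths. As always for an uncountable index set, this means that `X_f` has
a version with almost surely bounded paths. -/
def pisierClass (μ : Measure UnitAddCircle) : Set C(UnitAddCircle, ℂ) :=
  {f | ∃ (Ω : Type) (_ : MeasurableSpace Ω) (P : Measure Ω) (X : UnitAddCircle → Ω → ℂ),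
    IsProbabilityMeasure P ∧
    IsComplexGaussianProcess (translateCov μ f) X P ∧
    ∀ᵐ ω ∂P, ∃ C : ℝ, ∀ t, ‖X t ω‖ ≤ C}

/-- `|k|^(2H)` for an integer `k`, with value `0` at `k = 0`, also when `H = 0` (where Mathlib's
power would give `0 ^ 0 = 1`). -/
noncomputable def absPow (H : ℝ) (k : ℤ) : ℝ :=
  if k = 0 then 0 else |(k : ℝ)| ^ (2 * H)

/-- The covariance function of fractional Gaussian noise of index `H`. -/
noncomputable def fgnCov (H : ℝ) (k : ℤ) : ℝ :=
  absPow H (k + 1) / 2 + absPow H (k - 1) / 2 - absPow H k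

/-- `Δ` is a complex fractional Gaussian noise of index `H` on the probability space `(Ω, P)`. -/
def IsFractionalGaussianNoise {Ω : Type} [MeasurableSpace Ω] (H : ℝ) (Δ : ℤ → Ω → ℂ)
    (P : Measure Ω) : Prop :=
  IsProbabilityMeasure P ∧ IsComplexGaussianProcess (fun n m => (fgnCov H (n - m) : ℂ)) Δ P

/-- `μ` is the spectral measure of the stationary sequence `ξ`: a Borel probability measure on the
circle with `E (ξ_n * conj ξ_m) = ∫ exp (2πi (n - m) t) dμ(t)` for all integers `n`, `m`. There is
at most one such measure, since a finite measure is determined by its Fourier coefficients. -/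
def IsSpectralMeasure {Ω : Type} [MeasurableSpace Ω] (ξ : ℤ → Ω → ℂ) (P : Measure Ω)
    (μ : Measure UnitAddCircle) : Prop :=
  IsProbabilityMeasure μ ∧
  ∀ n m : ℤ, ∫ ω, ξ n ω * conj (ξ m ω) ∂P = ∫ t, fourier (n - m) t ∂μ

/-- `𝒫(H)`: the class `𝒫(μ)` for the spectral measure `μ` of fractional Gaussian noise of index
`H`. -/
def fgnPisierClass (H : ℝ) : Set C(UnitAddCircle, ℂ) :=
  {f | ∃ (Ω : Type) (_ : MeasurableSpace Ω) (P : Measure Ω) (Δ : ℤ → Ω → ℂ)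
      (μ : Measure UnitAddCircle),
    IsFractionalGaussianNoise H Δ P ∧ IsSpectralMeasure Δ P μ ∧ f ∈ pisierClass μ}

/-! The proof compares spectral measures: if `μ ≤ c • ν`, then 𝒫(ν) ⊂ 𝒫(μ), and for H₁ < H₂ the
measure μ_{H₁} is at most a multiple of μ_{H₂}.

Monotonicity (`pisierClass_subset_of_le_smul`). The covariance is additive in the measure, so with κ
= cν - μ and independent X_f(μ), X_f(κ), both X_f(μ) + X_f(κ) and X_f(μ) - X_f(κ) have the law of √c
X_f(ν). Both are therefore almost surely bounded, and so is their half-sum X_f(μ). Independence is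
realised by orthogonality in an isonormal process. Boundedness is transferred along a dense
sequence, where it is an event determined by the law, and L²-continuity in t yields a bounded
modification on the whole circle.

Domination (`exists_dominated_spectral_measures`). For H > 0, scaling gives ∫ (1 - cos 2πnx)
|x|^{-2H-1} dx = D |n|^{2H}, so μ_H is the normalised image on the circle of (1 - cos 2πx)
|x|^{-2H-1} dx; for H = 0 the indicator of [-1, 1] replaces the power. On |x| ≤ 1 the weight of H₁
is at most that of H₂. For |x| > 1 this fails on the line, but the factor 1 - cos 2πx is periodic
and the weight is summable over integer translates, so on the circle the tail costs only a constant
factor. -/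

/-! ### Real isonormal processes. -/

/-- The coordinates on a product of standard Gaussian measures form a Gaussian process. -/
theorem isGaussianProcess_eval_infinitePi (ι : Type) :
    IsGaussianProcess (fun (i : ι) (ω : ι → ℝ) => ω i)
      (Measure.infinitePi fun _ : ι => gaussianReal 0 1) where
  hasGaussianLaw I := by
    have h := iIndepFun_infinitePi (P := fun _ : ι => gaussianReal 0 1)
      (X := fun _ (x : ℝ) => x) (by fun_prop)
    refine iIndepFun.hasGaussianLaw (X := fun (i : I) (ω : ι → ℝ) => ω i) (fun i => ⟨?_⟩)
      (h.precomp Subtype.val_injective)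
    rw [(measurePreserving_eval_infinitePi (fun _ : ι => gaussianReal 0 1) (i : ι)).map_eq]
    infer_instance

theorem memLp_eval_infinitePi {ι : Type} (i : ι) :
    MemLp (fun ω : ι → ℝ => ω i) 2 (Measure.infinitePi fun _ : ι => gaussianReal 0 1) :=
  ((isGaussianProcess_eval_infinitePi ι).hasGaussianLaw_eval i).memLp_two

theorem integral_eval_infinitePi {ι : Type} (i : ι) :
    ∫ ω : ι → ℝ, ω i ∂(Measure.infinitePi fun _ : ι => gaussianReal 0 1) = 0 := by
  have h := (measurePreserving_eval_infinitePi (fun _ : ι => gaussianReal 0 1) i)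
  have := integral_map (μ := Measure.infinitePi fun _ : ι => gaussianReal 0 1)
    (φ := fun ω : ι → ℝ => ω i) (measurable_pi_apply i).aemeasurable (f := fun x => x) (by fun_prop)
  rw [← this]
  erw [h.map_eq]
  exact integral_id_gaussianReal

theorem integral_eval_mul_eval_infinitePi {ι : Type} [DecidableEq ι] (i j : ι) :
    ∫ ω : ι → ℝ, ω i * ω j ∂(Measure.infinitePi fun _ : ι => gaussianReal 0 1)
      = if i = j then 1 else 0 := by
  split_ifs with hij
  · subst hij
    have h := (measurePreserving_eval_infinitePi (fun _ : ι => gaussianReal 0 1) i)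
    have := integral_map (μ := Measure.infinitePi fun _ : ι => gaussianReal 0 1)
      (φ := fun ω : ι → ℝ => ω i) (measurable_pi_apply i).aemeasurable (f := fun x => x * x) (by fun_prop)
    rw [← this]
    erw [h.map_eq]
    have hv := variance_fun_id_gaussianReal (μ := 0) (v := 1)
    rw [variance_of_integral_eq_zero (by fun_prop) integral_id_gaussianReal] at hv
    simpa [sq] using hv
  · have h := iIndepFun_infinitePi (P := fun _ : ι => gaussianReal 0 1)
      (X := fun _ (x : ℝ) => x) (by fun_prop)
    have := (h.indepFun hij).integral_mul_eq_mul_integral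
      (memLp_eval_infinitePi i).1 (memLp_eval_infinitePi j).1
    simp only [Pi.mul_def] at this
    rw [this, integral_eval_infinitePi, zero_mul]

theorem Lp.integral_norm_le_norm_two {Ω : Type*} [MeasurableSpace Ω] {P : Measure Ω}
    [IsProbabilityMeasure P] {F : Type*} [NormedAddCommGroup F] (g : Lp F 2 P) :
    ∫ ω, ‖g ω‖ ∂P ≤ ‖g‖ := by
  rw [Lp.norm_def, integral_norm_eq_lintegral_enorm (Lp.aestronglyMeasurable g),
    ← eLpNorm_one_eq_lintegral_enorm]
  exact ENNReal.toReal_mono (Lp.eLpNorm_ne_top g)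
    (eLpNorm_le_eLpNorm_of_exponent_le (by norm_num) (Lp.aestronglyMeasurable g))

/-- Follows from |e^{ia} - 1| ≤ |a| and L¹ ≤ L² on a probability space. It lets Gaussian laws pass
to L² limits. -/
theorem charFun_map_lipschitz {Ω : Type*} [MeasurableSpace Ω] {P : Measure Ω}
    [IsProbabilityMeasure P] (t : ℝ) (f g : Lp ℝ 2 P) :
    dist (charFun (P.map f) t) (charFun (P.map g) t) ≤ |t| * dist f g := by
  have hi (f : Lp ℝ 2 P) : Integrable (fun ω => Complex.exp (t * f ω * Complex.I)) P := by
    refine Integrable.of_bound (C := 1) ?_ (Filter.Eventually.of_forall fun ω => ?_)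
    · have := Lp.aestronglyMeasurable f
      fun_prop
    · rw [← Complex.ofReal_mul, Complex.norm_exp_ofReal_mul_I]
  have hf (f : Lp ℝ 2 P) :
      charFun (P.map f) t = ∫ ω, Complex.exp (t * f ω * Complex.I) ∂P := by
    rw [charFun_apply_real, integral_map (Lp.aestronglyMeasurable f).aemeasurable (by fun_prop)]
  rw [dist_eq_norm, hf, hf, ← integral_sub (hi f) (hi g), dist_eq_norm]
  calc _ ≤ ∫ ω, ‖Complex.exp (t * f ω * Complex.I) - Complex.exp (t * g ω * Complex.I)‖ ∂P :=
        norm_integral_le_integral_norm _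
    _ ≤ ∫ ω, |t| * ‖(f - g) ω‖ ∂P := by
        refine integral_mono_ae ((hi f).sub (hi g)).norm
          (((Lp.memLp (f - g)).integrable (by norm_num)).norm.const_mul _) ?_
        filter_upwards [Lp.coeFn_sub f g] with ω h
        rw [h, Pi.sub_apply]
        have e : Complex.exp (t * f ω * Complex.I) - Complex.exp (t * g ω * Complex.I)
            = Complex.exp ((t * g ω : ℝ) * Complex.I) *
              (Complex.exp (Complex.I * (t * (f ω - g ω) : ℝ)) - 1) := by
          rw [mul_sub, ← Complex.exp_add]
          push_cast
          ring_nf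
        rw [e, norm_mul, Complex.norm_exp_ofReal_mul_I, one_mul]
        refine (Real.norm_exp_I_mul_ofReal_sub_one_le).trans ?_
        rw [norm_mul, Real.norm_eq_abs]
    _ ≤ |t| * ‖f - g‖ := by
        rw [integral_const_mul]
        exact mul_le_mul_of_nonneg_left (Lp.integral_norm_le_norm_two _) (abs_nonneg t)

/-- The isonormal Gaussian process on a real Hilbert space. -/
theorem exists_isonormal (E : Type) [NormedAddCommGroup E] [InnerProductSpace ℝ E]
    [CompleteSpace E] :
    ∃ (Ω : Type) (_ : MeasurableSpace Ω) (P : Measure Ω) (_ : IsProbabilityMeasure P)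
      (U : E →ₗᵢ[ℝ] Lp ℝ 2 P), ∀ v, P.map (U v) = gaussianReal 0 (‖v‖₊ ^ 2) := by
  classical
  obtain ⟨w, b, -⟩ := exists_hilbertBasis ℝ E
  let P : Measure (w → ℝ) := Measure.infinitePi fun _ : w => gaussianReal 0 1
  let e : w → Lp ℝ 2 P := fun i => (memLp_eval_infinitePi i).toLp
  have he : Orthonormal ℝ e := by
    rw [orthonormal_iff_ite]
    intro i j
    rw [L2.inner_def, ← integral_eval_mul_eval_infinitePi i j]
    refine integral_congr_ae ?_
    filter_upwards [(memLp_eval_infinitePi i).coeFn_toLp, (memLp_eval_infinitePi j).coeFn_toLp]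
      with ω h1 h2
    simp only [e]
    rw [h1, h2]
    simp [mul_comm]
  let U : E →ₗᵢ[ℝ] Lp ℝ 2 P :=
    he.orthogonalFamily.linearIsometry.comp b.repr.toLinearIsometry
  have hU (i : w) : U (b i) = e i := by
    simp [U, HilbertBasis.repr_self, LinearIsometry.toSpanSingleton]
  have hsum (s : Finset w) (c : w → ℝ) :
      (U (∑ i ∈ s, c i • b i) : (w → ℝ) → ℝ) =ᵐ[P] fun ω => ∑ i ∈ s, c i * ω i := by
    simp only [map_sum, map_smul, hU]
    induction s using Finset.induction_on with
    | empty => simp only [Finset.sum_empty]; exact Lp.coeFn_zero ℝ 2 P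
    | insert i s hi ih =>
      simp only [Finset.sum_insert hi]
      filter_upwards [Lp.coeFn_add (c i • e i) (∑ j ∈ s, c j • e j), Lp.coeFn_smul (c i) (e i),
        (memLp_eval_infinitePi i).coeFn_toLp, ih] with ω h1 h2 h3 h4
      simp only [h1, Pi.add_apply, h2, Pi.smul_apply, h4, smul_eq_mul]
      rw [← h3]
  have hchar (v : E) (t : ℝ) :
      charFun (P.map (U v)) t = charFun (gaussianReal 0 (‖v‖₊ ^ 2)) t := by
    -- Both sides are continuous in `v`, so it suffices to treat the partial sums of the basis
    -- expansion, which are finite combinations of independent standard Gaussians.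
    have hcl : IsClosed {v : E | charFun (P.map (U v)) t
        = charFun (gaussianReal 0 (‖v‖₊ ^ 2)) t} := by
      refine isClosed_eq ?_ ?_
      · refine Continuous.comp (g := fun f : Lp ℝ 2 P => charFun (P.map f) t) ?_ U.continuous
        refine (LipschitzWith.of_dist_le_mul (K := ‖t‖₊) fun f g => ?_).continuous
        simpa using charFun_map_lipschitz t f g
      · simp only [charFun_gaussianReal]
        push_cast
        fun_prop
    refine hcl.mem_of_tendsto (b.hasSum_repr v) (Filter.Eventually.of_forall fun s => ?_)
    simp only [Set.mem_ofPred_eq]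
    have hG : HasGaussianLaw (U (∑ i ∈ s, b.repr v i • b i)) P :=
      (((isGaussianProcess_eval_infinitePi w).smul fun i => b.repr v i).hasGaussianLaw_fun_sum
        (I := s)).congr (hsum s _).symm
    have hm : ∫ ω, U (∑ i ∈ s, b.repr v i • b i) ω ∂P = 0 := by
      rw [integral_congr_ae (hsum s _), integral_finsetSum]
      · simp [integral_const_mul, P, integral_eval_infinitePi]
      · exact fun i _ => ((memLp_eval_infinitePi i).integrable (by norm_num)).const_mul _
    rw [hG.map_eq_gaussianReal, hm, variance_of_integral_eq_zero hG.aemeasurable hm]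
    congr 2
    rw [← U.nnnorm_map]
    ext
    have h2 := L2.inner_def (𝕜 := ℝ) (U (∑ i ∈ s, b.repr v i • b i)) (U (∑ i ∈ s, b.repr v i • b i))
    rw [real_inner_self_eq_norm_sq] at h2
    rw [NNReal.coe_pow, coe_nnnorm, h2, Real.coe_toNNReal _ (integral_nonneg fun ω => sq_nonneg _)]
    refine integral_congr_ae (Filter.Eventually.of_forall fun ω => ?_)
    simp [sq]
  refine ⟨w → ℝ, inferInstance, P, inferInstance, U, fun v => ?_⟩
  have : IsProbabilityMeasure (P.map (U v)) :=
    Measure.isProbabilityMeasure_map (Lp.aestronglyMeasurable _).aemeasurable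
  exact Measure.ext_of_charFun (funext (hchar v))

theorem isGaussianProcess_of_isonormal {E Ω : Type} [NormedAddCommGroup E]
    [InnerProductSpace ℝ E] [MeasurableSpace Ω] {P : Measure Ω} [IsProbabilityMeasure P]
    (U : E →ₗᵢ[ℝ] Lp ℝ 2 P) (hU : ∀ v, P.map (U v) = gaussianReal 0 (‖v‖₊ ^ 2)) :
    IsGaussianProcess (fun v => (U v : Ω → ℝ)) P where
  hasGaussianLaw I := by
    classical
    have hmeas : AEMeasurable (fun ω => I.restrict fun v => (U v : Ω → ℝ) ω) P :=
      aemeasurable_pi_lambda _ fun i => (Lp.aestronglyMeasurable (U i)).aemeasurable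
    refine ⟨isGaussian_of_map_eq_gaussianReal fun L => ⟨0, ‖∑ i : I, L (Pi.single i 1) • (i : E)‖₊ ^ 2,
      ?_⟩⟩
    rw [← hU, AEMeasurable.map_map_of_aemeasurable (by fun_prop) hmeas]
    refine Measure.map_congr ?_
    have hsum (s : Finset I) : (U (∑ i ∈ s, L (Pi.single i 1) • (i : E)) : Ω → ℝ)
        =ᵐ[P] fun ω => ∑ i ∈ s, L (Pi.single i 1) * U i ω := by
      simp only [map_sum, map_smul]
      induction s using Finset.induction_on with
      | empty => simp only [Finset.sum_empty]; exact Lp.coeFn_zero ℝ 2 P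
      | insert i s hi ih =>
        simp only [Finset.sum_insert hi]
        filter_upwards [Lp.coeFn_add (L (Pi.single i 1) • U i) (∑ j ∈ s, L (Pi.single j 1) • U j),
          Lp.coeFn_smul (L (Pi.single i 1)) (U i), ih] with ω h1 h2 h3
        simp only [h1, Pi.add_apply, h2, Pi.smul_apply, h3, smul_eq_mul]
    filter_upwards [hsum Finset.univ] with ω h
    rw [h, Function.comp_apply]
    conv_lhs => rw [← Finset.univ_sum_single (I.restrict fun v => (U v : Ω → ℝ) ω), map_sum]
    refine Finset.sum_congr rfl fun i _ => ?_
    have : (Pi.single i (I.restrict (fun v => (U v : Ω → ℝ) ω) i) : I → ℝ)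
        = (U i ω) • Pi.single i 1 := by
      rw [← Pi.single_smul]; simp
    rw [this, map_smul, smul_eq_mul, mul_comm]

/-! ### Circularly symmetric complex Gaussian processes and their laws. -/

theorem IsComplexGaussianProcess.memLp_two {ι Ω : Type} [MeasurableSpace Ω]
    {K : ι → ι → ℂ} {X : ι → Ω → ℂ} {P : Measure Ω} (hX : IsComplexGaussianProcess K X P)
    (t : ι) : MemLp (X t) 2 P :=
  (hX.isGaussian.hasGaussianLaw_eval t).memLp_two

theorem IsComplexGaussianProcess.isProbabilityMeasure {ι Ω : Type} [MeasurableSpace Ω]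
    {K : ι → ι → ℂ} {X : ι → Ω → ℂ} {P : Measure Ω} (hX : IsComplexGaussianProcess K X P) :
    IsProbabilityMeasure P :=
  hX.isGaussian.isProbabilityMeasure

theorem IsComplexGaussianProcess.comp_right {ι κ Ω : Type} [MeasurableSpace Ω]
    {K : ι → ι → ℂ} {X : ι → Ω → ℂ} {P : Measure Ω} (hX : IsComplexGaussianProcess K X P)
    (e : κ → ι) : IsComplexGaussianProcess (fun t s => K (e t) (e s)) (fun t => X (e t)) P where
  isGaussian := hX.isGaussian.comp_right e
  mean_eq_zero _ := hX.mean_eq_zero _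
  covariance_eq _ _ := hX.covariance_eq _ _
  pseudoCovariance_eq_zero _ _ := hX.pseudoCovariance_eq_zero _ _

/-- A modification of a complex Gaussian process is a complex Gaussian process. -/
theorem IsComplexGaussianProcess.congr {ι Ω : Type} [MeasurableSpace Ω]
    {K : ι → ι → ℂ} {X Y : ι → Ω → ℂ} {P : Measure Ω} (hX : IsComplexGaussianProcess K X P)
    (h : ∀ t, X t =ᵐ[P] Y t) : IsComplexGaussianProcess K Y P where
  isGaussian := hX.isGaussian.congr h
  mean_eq_zero t := by rw [← hX.mean_eq_zero t, integral_congr_ae (h t)]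
  covariance_eq t s := by
    rw [← hX.covariance_eq t s]
    refine integral_congr_ae ?_
    filter_upwards [h t, h s] with ω h1 h2
    rw [h1, h2]
  pseudoCovariance_eq_zero t s := by
    rw [← hX.pseudoCovariance_eq_zero t s]
    refine integral_congr_ae ?_
    filter_upwards [h t, h s] with ω h1 h2
    rw [h1, h2]

/-- The circularly symmetric isonormal Gaussian process on a complex Hilbert space. -/
theorem exists_complex_isonormal (E : Type) [NormedAddCommGroup E] [InnerProductSpace ℂ E]
    [CompleteSpace E] :
    ∃ (Ω : Type) (_ : MeasurableSpace Ω) (P : Measure Ω) (Z : E → Ω → ℂ),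
      IsComplexGaussianProcess (fun v w => inner ℂ w v) Z P ∧
      ∀ v w, Z (v + w) =ᵐ[P] Z v + Z w := by
  let _ : InnerProductSpace ℝ E := InnerProductSpace.rclikeToReal ℂ E
  obtain ⟨Ω, mΩ, P, hP, U, hU⟩ := exists_isonormal E
  have hG := isGaussianProcess_of_isonormal U hU
  have hm (v : E) : ∫ ω, U v ω ∂P = 0 := by
    have := integral_map (Lp.aestronglyMeasurable (U v)).aemeasurable
      (f := fun x : ℝ => x) (by fun_prop)
    rw [← this, hU]
    exact integral_id_gaussianReal
  have hc (v w : E) : ∫ ω, U v ω * U w ω ∂P = (inner ℂ w v : ℂ).re := by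
    have h := L2.inner_def (𝕜 := ℝ) (U w) (U v)
    rw [U.inner_map_map] at h
    exact h.symm
  have hi (v : E) : Integrable (U v) P := (Lp.memLp (U v)).integrable (by norm_num)
  have hi2 (v w : E) : Integrable (fun ω => U v ω * U w ω) P :=
    (Lp.memLp (U v)).integrable_mul (Lp.memLp (U w))
  have hi3 (v w : E) : Integrable (fun ω => ((U v ω * U w ω : ℝ) : ℂ)) P := (hi2 v w).ofReal
  let c : ℂ := ((√2)⁻¹ : ℝ)
  have hcc : c * c = 1 / 2 := by
    simp only [c]
    rw [← Complex.ofReal_mul, ← mul_inv, Real.mul_self_sqrt (by norm_num)]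
    norm_num
  have hconj : conj c = c := Complex.conj_ofReal _
  -- This is the complex-linear part of `U`, up to the factor making it isometric. Multiplication by
  -- i preserves the real inner product, so the terms of E(Z_v Z_w) cancel, while those of E(Z_v
  -- conj Z_w) add up to the full complex inner product.
  let Z : E → Ω → ℂ := fun v ω => c * (U v ω - Complex.I * U (Complex.I • v) ω)
  refine ⟨Ω, mΩ, P, Z, ⟨?_, fun v => ?_, fun v w => ?_, fun v w => ?_⟩, fun v w => ?_⟩
  · classical
    refine hG.of_isGaussianProcess fun v => ⟨{v, Complex.I • v}, ?_⟩
    let L : (({v, Complex.I • v} : Finset E) → ℝ) →L[ℝ] ℂ :=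
      { toFun := fun x => c * (x ⟨v, by simp⟩ - Complex.I * x ⟨Complex.I • v, by simp⟩)
        map_add' := fun x y => by simp only [Pi.add_apply]; push_cast; ring
        map_smul' := fun r x => by
          simp only [Pi.smul_apply, smul_eq_mul, RingHom.id_apply, Complex.real_smul]
          push_cast; ring
        cont := by fun_prop }
    exact ⟨L, fun ω => rfl⟩
  · simp only [Z]
    rw [integral_const_mul, integral_sub (hi v).ofReal ((hi _).ofReal.const_mul _),
      integral_const_mul, integral_complex_ofReal, integral_complex_ofReal, hm, hm]
    simp
  · have e (ω : Ω) : Z v ω * conj (Z w ω) = c * c * (((U v ω * U w ω : ℝ) +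
        (U (Complex.I • v) ω * U (Complex.I • w) ω : ℝ)) +
        Complex.I * ((U v ω * U (Complex.I • w) ω : ℝ) - (U (Complex.I • v) ω * U w ω : ℝ))) := by
      simp only [Z, map_mul, map_sub, hconj, Complex.conj_ofReal, Complex.conj_I]
      push_cast
      linear_combination (-c * c * U (Complex.I • v) ω * U (Complex.I • w) ω) * Complex.I_sq
    simp only [e]
    rw [integral_const_mul, integral_add, integral_add, integral_const_mul, integral_sub]
    · simp only [integral_complex_ofReal, hc, inner_smul_left, inner_smul_right, hcc]
      apply Complex.ext <;> simp <;> ring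
    all_goals fun_prop
  · have e (ω : Ω) : Z v ω * Z w ω = c * c * (((U v ω * U w ω : ℝ) -
        (U (Complex.I • v) ω * U (Complex.I • w) ω : ℝ)) -
        Complex.I * ((U v ω * U (Complex.I • w) ω : ℝ) + (U (Complex.I • v) ω * U w ω : ℝ))) := by
      simp only [Z]
      push_cast
      linear_combination (c * c * U (Complex.I • v) ω * U (Complex.I • w) ω) * Complex.I_sq
    simp only [e]
    rw [integral_const_mul, integral_sub, integral_sub, integral_const_mul, integral_add]
    · simp only [integral_complex_ofReal, hc, inner_smul_left, inner_smul_right, hcc]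
      apply Complex.ext <;> simp
    all_goals fun_prop
  · have h1 : (U (v + w) : Ω → ℝ) =ᵐ[P] U v + U w := by
      rw [map_add]; exact Lp.coeFn_add _ _
    have h2 : (U (Complex.I • (v + w)) : Ω → ℝ) =ᵐ[P] U (Complex.I • v) + U (Complex.I • w) := by
      rw [smul_add, map_add]; exact Lp.coeFn_add _ _
    filter_upwards [h1, h2] with ω h1 h2
    simp only [Z, h1, h2, Pi.add_apply]
    push_cast
    ring

theorem ContinuousLinearMap.exists_re_sum_mul {I : Type} [Fintype I] (L : (I → ℂ) →L[ℝ] ℝ) :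
    ∃ c : I → ℂ, ∀ x, L x = (∑ i, c i * x i).re := by
  classical
  -- The coefficients come from Re((a - ib)(x + iy)) = ax + by.
  refine ⟨fun i => L (Pi.single i 1) - Complex.I * L (Pi.single i Complex.I), fun x => ?_⟩
  conv_lhs => rw [← Finset.univ_sum_single x, map_sum]
  rw [Complex.re_sum]
  refine Finset.sum_congr rfl fun i _ => ?_
  have : (Pi.single i (x i) : I → ℂ)
      = (x i).re • (Pi.single i 1 : I → ℂ) + (x i).im • (Pi.single i Complex.I : I → ℂ) := by
    rw [← Pi.single_smul, ← Pi.single_smul, ← Pi.single_add]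
    congr 1
    apply Complex.ext <;> simp
  rw [this, map_add, map_smul, map_smul]
  simp
  ring

/-- Linear functionals of a centred circular Gaussian vector: mean and second moment. -/
theorem IsComplexGaussianProcess.integral_re_sum_sq {ι Ω I : Type} [MeasurableSpace Ω] [Fintype I]
    {K : ι → ι → ℂ} {X : ι → Ω → ℂ} {P : Measure Ω} (hX : IsComplexGaussianProcess K X P)
    (t : I → ι) (c : I → ℂ) :
    ∫ ω, (∑ i, c i * X (t i) ω).re ∂P = 0 ∧
    ∫ ω, ((∑ i, c i * X (t i) ω).re) ^ 2 ∂P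
      = (∑ i, ∑ j, c i * conj (c j) * K (t i) (t j)).re / 2 := by
  have := hX.isProbabilityMeasure
  have hm (i : ι) := hX.memLp_two i
  have hi (i : ι) : Integrable (X i) P := (hm i).integrable (by norm_num)
  have hi2 (i j : ι) : Integrable (fun ω => X i ω * X j ω) P := (hm i).integrable_mul (hm j)
  have hi3 (i j : ι) : Integrable (fun ω => X i ω * conj (X j ω)) P :=
    (hm i).integrable_mul (hm j).star
  constructor
  · have h : Integrable (fun ω => ∑ i, c i * X (t i) ω) P :=
      integrable_finsetSum _ fun i _ => (hi _).const_mul _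
    have := integral_re h
    simp only [RCLike.re_to_complex] at this
    rw [this, integral_finsetSum _ fun i _ => (hi _).const_mul _]
    simp [integral_const_mul, hX.mean_eq_zero]
  -- Uses (Re z)² = Re(z conj z + z²)/2; circular symmetry makes the z² term vanish in mean.
  · have e (ω : Ω) : ((∑ i, c i * X (t i) ω).re) ^ 2 =
        ((1 / 2 : ℂ) * ((∑ i, ∑ j, c i * conj (c j) * (X (t i) ω * conj (X (t j) ω))) +
          ∑ i, ∑ j, c i * c j * (X (t i) ω * X (t j) ω))).re := by
      have e1 : (∑ i, ∑ j, c i * conj (c j) * (X (t i) ω * conj (X (t j) ω)))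
          = (∑ i, c i * X (t i) ω) * conj (∑ i, c i * X (t i) ω) := by
        rw [map_sum, Finset.sum_mul_sum]
        simp only [map_mul]
        exact Finset.sum_congr rfl fun i _ => Finset.sum_congr rfl fun j _ => by ring
      have e2 : (∑ i, ∑ j, c i * c j * (X (t i) ω * X (t j) ω))
          = (∑ i, c i * X (t i) ω) * (∑ i, c i * X (t i) ω) := by
        rw [Finset.sum_mul_sum]
        exact Finset.sum_congr rfl fun i _ => Finset.sum_congr rfl fun j _ => by ring
      rw [e1, e2]
      generalize (∑ i, c i * X (t i) ω) = z
      simp [Complex.mul_re]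
      ring
    have i1 : Integrable (fun ω => ∑ i, ∑ j, c i * conj (c j) * (X (t i) ω * conj (X (t j) ω))) P :=
      integrable_finsetSum _ fun i _ => integrable_finsetSum _ fun j _ => (hi3 _ _).const_mul _
    have i2 : Integrable (fun ω => ∑ i, ∑ j, c i * c j * (X (t i) ω * X (t j) ω)) P :=
      integrable_finsetSum _ fun i _ => integrable_finsetSum _ fun j _ => (hi2 _ _).const_mul _
    have := integral_re ((i1.add i2).const_mul (1 / 2 : ℂ))
    simp only [RCLike.re_to_complex, Pi.add_apply] at this
    simp only [e]
    rw [this, integral_const_mul, integral_add i1 i2,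
      integral_finsetSum _ fun i _ => integrable_finsetSum _ fun j _ => (hi3 _ _).const_mul _,
      integral_finsetSum _ fun i _ => integrable_finsetSum _ fun j _ => (hi2 _ _).const_mul _]
    have a1 (i : I) : ∫ ω, ∑ j, c i * conj (c j) * (X (t i) ω * conj (X (t j) ω)) ∂P
        = ∑ j, c i * conj (c j) * K (t i) (t j) := by
      rw [integral_finsetSum _ fun j _ => (hi3 _ _).const_mul _]
      simp only [integral_const_mul, hX.covariance_eq]
    have a2 (i : I) : ∫ ω, ∑ j, c i * c j * (X (t i) ω * X (t j) ω) ∂P = 0 := by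
      rw [integral_finsetSum _ fun j _ => (hi2 _ _).const_mul _]
      simp only [integral_const_mul, hX.pseudoCovariance_eq_zero, mul_zero, Finset.sum_const_zero]
    simp only [a1, a2, Finset.sum_const_zero, add_zero]
    simp
    ring

/-- A Gaussian variable is determined by its mean and variance. The point is that the right-hand
side involves only `K` and `c`, not the process. -/
theorem IsComplexGaussianProcess.charFunDual_map {ι Ω : Type} [MeasurableSpace Ω]
    {K : ι → ι → ℂ} {X : ι → Ω → ℂ} {P : Measure Ω} (hX : IsComplexGaussianProcess K X P)
    (I : Finset ι) (L : (I → ℂ) →L[ℝ] ℝ) (c : I → ℂ) (hc : ∀ x, L x = (∑ i, c i * x i).re) :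
    charFunDual (P.map fun ω => I.restrict (X · ω)) L =
      Complex.exp (-(((∑ i, ∑ j, c i * conj (c j) * K i j).re / 2 : ℝ) : ℂ) / 2) := by
  have h := hX.integral_re_sum_sq (fun i : I => (i : ι)) c
  have hG := hX.isGaussian.hasGaussianLaw I
  rw [hG.charFunDual_map_eq_fun]
  have e (ω : Ω) : L (I.restrict (X · ω)) = (∑ i, c i * X i ω).re := hc _
  simp only [e]
  have hae : AEMeasurable (fun ω => (∑ i, c i * X i ω).re) P := by
    simp only [← e]
    exact (hG.map_fun L).aemeasurable
  rw [variance_of_integral_eq_zero hae h.1, h.1, h.2]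
  congr 1
  push_cast
  ring

/-- The covariance function determines the law of a circular Gaussian sequence. -/
theorem IsComplexGaussianProcess.map_eq_map {ι Ω Ω' : Type} [Countable ι] [MeasurableSpace Ω]
    [MeasurableSpace Ω'] {K : ι → ι → ℂ} {X : ι → Ω → ℂ} {P : Measure Ω} {Y : ι → Ω' → ℂ}
    {Q : Measure Ω'} (hX : IsComplexGaussianProcess K X P) (hY : IsComplexGaussianProcess K Y Q) :
    P.map (fun ω t => X t ω) = Q.map (fun ω t => Y t ω) := by
  have := hX.isProbabilityMeasure
  have := hY.isProbabilityMeasure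
  have aX : AEMeasurable (fun ω t => X t ω) P :=
    aemeasurable_pi_lambda _ fun t => hX.isGaussian.aemeasurable t
  have aY : AEMeasurable (fun ω t => Y t ω) Q :=
    aemeasurable_pi_lambda _ fun t => hY.isGaussian.aemeasurable t
  refine IsProjectiveLimit.unique (isProjectiveLimit_map aX) ?_
  convert isProjectiveLimit_map aY using 1
  ext1 I
  have h1 := (hX.isGaussian.hasGaussianLaw I).isGaussian_map
  have h2 := (hY.isGaussian.hasGaussianLaw I).isGaussian_map
  refine Measure.ext_of_charFunDual (funext fun L => ?_)
  obtain ⟨c, hc⟩ := L.exists_re_sum_mul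
  rw [hX.charFunDual_map I L c hc, hY.charFunDual_map I L c hc]

theorem measurableSet_bounded_paths {ι : Type} [Countable ι] :
    MeasurableSet {x : ι → ℂ | ∃ C : ℝ, ∀ t, ‖x t‖ ≤ C} := by
  have : {x : ι → ℂ | ∃ C : ℝ, ∀ t, ‖x t‖ ≤ C} = ⋃ n : ℕ, ⋂ t, {x | ‖x t‖ ≤ n} := by
    ext x
    simp only [Set.mem_ofPred_eq, Set.mem_iUnion, Set.mem_iInter]
    constructor
    · rintro ⟨C, hC⟩
      obtain ⟨n, hn⟩ := exists_nat_ge C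
      exact ⟨n, fun t => (hC t).trans hn⟩
    · rintro ⟨n, hn⟩
      exact ⟨n, hn⟩
  rw [this]
  exact MeasurableSet.iUnion fun n => MeasurableSet.iInter fun t =>
    measurableSet_le (by fun_prop) (by fun_prop)

/-- For a countable index set, bounded paths form a measurable event in the product space, so almost
sure boundedness depends on the covariance alone. -/
theorem IsComplexGaussianProcess.ae_bounded_of_ae_bounded {ι Ω Ω' : Type} [Countable ι]
    [MeasurableSpace Ω] [MeasurableSpace Ω'] {K : ι → ι → ℂ} {X : ι → Ω → ℂ} {P : Measure Ω}
    {Y : ι → Ω' → ℂ} {Q : Measure Ω'} (hX : IsComplexGaussianProcess K X P)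
    (hY : IsComplexGaussianProcess K Y Q) (hb : ∀ᵐ ω ∂P, ∃ C : ℝ, ∀ t, ‖X t ω‖ ≤ C) :
    ∀ᵐ ω ∂Q, ∃ C : ℝ, ∀ t, ‖Y t ω‖ ≤ C := by
  have aX : AEMeasurable (fun ω t => X t ω) P :=
    aemeasurable_pi_lambda _ fun t => hX.isGaussian.aemeasurable t
  have aY : AEMeasurable (fun ω t => Y t ω) Q :=
    aemeasurable_pi_lambda _ fun t => hY.isGaussian.aemeasurable t
  have h := (ae_map_iff aX measurableSet_bounded_paths).2 hb
  rw [hX.map_eq_map hY] at h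
  exact ae_of_ae_map aY h

/-! ### Bounded modifications and monotonicity of 𝒫(μ) in μ. -/

/-- If a family of random variables is sequentially continuous in `L²` and bounded along a
dense sequence almost surely, it has a modification with almost surely bounded paths. -/
theorem exists_modification_bounded {T Ω : Type} [TopologicalSpace T] [FirstCountableTopology T]
    [MeasurableSpace Ω] {P : Measure Ω} {Y : T → Ω → ℂ} {d : ℕ → T} (hd : DenseRange d)
    (hm : ∀ t, AEStronglyMeasurable (Y t) P)
    (hY : ∀ t, Filter.Tendsto (fun s => eLpNorm (Y s - Y t) 2 P) (nhds t) (nhds 0))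
    (hb : ∀ᵐ ω ∂P, ∃ C : ℝ, ∀ n, ‖Y (d n) ω‖ ≤ C) :
    ∃ Y' : T → Ω → ℂ, (∀ t, Y t =ᵐ[P] Y' t) ∧ ∀ᵐ ω ∂P, ∃ C : ℝ, ∀ t, ‖Y' t ω‖ ≤ C := by
  classical
  -- For fixed `t` this holds almost surely, since some sequence of values at points `d n` converges
  -- almost everywhere to `Y t`. Putting 0 where it fails makes each bound along `d` a bound for the
  -- whole path.
  let good (t : T) (ω : Ω) : Prop := ∀ C : ℝ, (∀ n, ‖Y (d n) ω‖ ≤ C) → ‖Y t ω‖ ≤ C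
  refine ⟨fun t ω => if good t ω then Y t ω else 0, fun t => ?_, ?_⟩
  · obtain ⟨x, hx, hxt⟩ := mem_closure_iff_seq_limit.1 (hd.closure_range ▸ Set.mem_univ t)
    have hconv : TendstoInMeasure P (fun n => Y (x n)) Filter.atTop (Y t) :=
      tendstoInMeasure_of_tendsto_eLpNorm (p := 2) (by norm_num) (fun n => hm _) (hm _)
        ((hY t).comp hxt)
    obtain ⟨ns, -, hns⟩ := hconv.exists_seq_tendsto_ae
    filter_upwards [hns] with ω hω
    have : good t ω := fun C hC => by
      refine le_of_tendsto hω.norm (Filter.Eventually.of_forall fun k => ?_)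
      obtain ⟨n, hn⟩ := hx (ns k)
      rw [← hn]
      exact hC n
    simp [this]
  · filter_upwards [hb] with ω ⟨C, hC⟩
    refine ⟨C, fun t => ?_⟩
    split_ifs with h
    · exact h C hC
    · rw [norm_zero]
      exact (norm_nonneg _).trans (hC 0)

/-- Additivity reduces the difference to `Z (v - w)`. This supplies the L²-continuity required by
`exists_modification_bounded`. -/
theorem eLpNorm_sub_complex_isonormal {E Ω : Type} [NormedAddCommGroup E] [InnerProductSpace ℂ E]
    [MeasurableSpace Ω] {P : Measure Ω} {Z : E → Ω → ℂ}
    (hZ : IsComplexGaussianProcess (fun v w => inner ℂ w v) Z P)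
    (hadd : ∀ v w, Z (v + w) =ᵐ[P] Z v + Z w) (v w : E) :
    eLpNorm (Z v - Z w) 2 P = ENNReal.ofReal ‖v - w‖ := by
  have h1 : Z v - Z w =ᵐ[P] Z (v - w) := by
    have := hadd (v - w) w
    rw [sub_add_cancel] at this
    filter_upwards [this] with ω h
    simp [h]
  rw [eLpNorm_congr_ae h1]
  generalize v - w = u
  rw [(hZ.memLp_two u).eLpNorm_eq_integral_rpow_norm (by norm_num) (by norm_num)]
  congr 1
  have h2 : ∫ ω, ‖Z u ω‖ ^ 2 ∂P = ‖u‖ ^ 2 := by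
    have := hZ.covariance_eq u u
    simp only [Complex.mul_conj, Complex.normSq_eq_norm_sq, inner_self_eq_norm_sq_to_K] at this
    rw [integral_complex_ofReal] at this
    exact Complex.ofReal_injective (by simpa using this)
  simp only [ENNReal.toReal_ofNat, Real.rpow_ofNat, h2]
  rw [inv_eq_one_div, ← Real.sqrt_eq_rpow, Real.sqrt_sq (norm_nonneg _)]

/-- The translate `u ↦ f (t + u)`. -/
noncomputable def circleTranslate (f : C(UnitAddCircle, ℂ)) : C(UnitAddCircle, C(UnitAddCircle, ℂ)) :=
  ContinuousMap.curry ⟨fun p => f (p.1 + p.2), by fun_prop⟩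

theorem inner_toLp_circleTranslate (μ : Measure UnitAddCircle) [IsFiniteMeasure μ]
    (f : C(UnitAddCircle, ℂ)) (t s : UnitAddCircle) :
    inner ℂ (ContinuousMap.toLp (E := ℂ) 2 μ ℂ (circleTranslate f s))
      (ContinuousMap.toLp (E := ℂ) 2 μ ℂ (circleTranslate f t)) = translateCov μ f t s := by
  rw [ContinuousMap.inner_toLp]
  rfl

theorem integrable_translateCov (μ : Measure UnitAddCircle) [IsFiniteMeasure μ]
    (f : C(UnitAddCircle, ℂ)) (t s : UnitAddCircle) :
    Integrable (fun u => f (t + u) * conj (f (s + u))) μ := by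
  refine Continuous.integrable_of_hasCompactSupport (by fun_prop) ?_
  exact HasCompactSupport.of_compactSpace _

/-- If `μ ≤ c • ν`, then `√c X_f(ν)` is in law the sum of `X_f(μ)` and an independent symmetric
process, so boundedness is inherited. -/
theorem pisierClass_subset_of_le_smul {μ ν : Measure UnitAddCircle} [IsFiniteMeasure μ]
    [IsFiniteMeasure ν] (c : NNReal) (h : μ ≤ c • ν) : pisierClass ν ⊆ pisierClass μ := by
  rintro f ⟨Ω, mΩ, P, X, hP, hX, hXb⟩
  let κ : Measure UnitAddCircle := c • ν - μ
  have hsum : κ + μ = c • ν := Measure.sub_add_cancel_of_le h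
  let a (t : UnitAddCircle) : Lp ℂ 2 μ := ContinuousMap.toLp (E := ℂ) 2 μ ℂ (circleTranslate f t)
  let b (t : UnitAddCircle) : Lp ℂ 2 κ := ContinuousMap.toLp (E := ℂ) 2 κ ℂ (circleTranslate f t)
  obtain ⟨Ω', mΩ', Q, Z, hZ, hadd⟩ :=
    exists_complex_isonormal (WithLp 2 (Lp ℂ 2 μ × Lp ℂ 2 κ))
  have hQ := hZ.isProbabilityMeasure
  -- The families (a, b) and (a, -b) have the same inner products, those of √c X_f(ν), and their sum
  -- is 2(a, 0), where (a, 0) carries the covariance of X_f(μ).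
  let ePos (t : UnitAddCircle) := WithLp.toLp 2 (a t, b t)
  let eNeg (t : UnitAddCircle) := WithLp.toLp 2 (a t, -b t)
  let e (t : UnitAddCircle) := WithLp.toLp 2 (a t, (0 : Lp ℂ 2 κ))
  have hcov (t s : UnitAddCircle) :
      translateCov μ f t s + translateCov κ f t s = c * translateCov ν f t s := by
    have h1 := integral_add_measure (integrable_translateCov κ f t s)
      (integrable_translateCov μ f t s)
    rw [hsum, integral_smul_nnreal_measure] at h1
    simp only [translateCov]
    rw [add_comm, ← h1]
    rfl
  let d := TopologicalSpace.denseSeq UnitAddCircle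
  have hd : DenseRange d := TopologicalSpace.denseRange_denseSeq _
  let r : ℝ := √c
  have hrr : (r : ℂ) * r = (c : ℂ) := by
    rw [← Complex.ofReal_mul]
    exact congrArg Complex.ofReal (Real.mul_self_sqrt c.2)
  have hX' : IsComplexGaussianProcess (fun n m => (c : ℂ) * translateCov ν f (d n) (d m))
      (fun n ω => (r : ℂ) * X (d n) ω) P := by
    refine ⟨?_, fun n => ?_, fun n m => ?_, fun n m => ?_⟩
    · simpa using (hX.comp_right d).isGaussian.smul fun _ => r
    · rw [integral_const_mul, hX.mean_eq_zero, mul_zero]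
    · rw [← hX.covariance_eq, ← integral_const_mul, ← hrr]
      refine integral_congr_ae (Filter.Eventually.of_forall fun ω => ?_)
      simp only [map_mul, Complex.conj_ofReal]
      ring
    · have := hX.pseudoCovariance_eq_zero (d n) (d m)
      rw [← mul_zero ((r : ℂ) * r), ← this, ← integral_const_mul]
      refine integral_congr_ae (Filter.Eventually.of_forall fun ω => ?_)
      ring
  have hX'b : ∀ᵐ ω ∂P, ∃ C : ℝ, ∀ n, ‖(r : ℂ) * X (d n) ω‖ ≤ C := by
    filter_upwards [hXb] with ω ⟨C, hC⟩
    refine ⟨‖(r : ℂ)‖ * C, fun n => ?_⟩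
    rw [norm_mul]
    exact mul_le_mul_of_nonneg_left (hC _) (norm_nonneg _)
  have hpos : ∀ᵐ ω ∂Q, ∃ C : ℝ, ∀ n, ‖Z (ePos (d n)) ω‖ ≤ C := by
    refine hX'.ae_bounded_of_ae_bounded (Y := fun n => Z (ePos (d n))) ?_ hX'b
    convert hZ.comp_right fun n => ePos (d n) using 1
    ext n m
    rw [← hcov, ← inner_toLp_circleTranslate, ← inner_toLp_circleTranslate]
    simp [ePos, a, b, WithLp.prod_inner_apply]
  have hneg : ∀ᵐ ω ∂Q, ∃ C : ℝ, ∀ n, ‖Z (eNeg (d n)) ω‖ ≤ C := by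
    refine hX'.ae_bounded_of_ae_bounded (Y := fun n => Z (eNeg (d n))) ?_ hX'b
    convert hZ.comp_right fun n => eNeg (d n) using 1
    ext n m
    rw [← hcov, ← inner_toLp_circleTranslate, ← inner_toLp_circleTranslate]
    simp [eNeg, a, b, WithLp.prod_inner_apply]
  have hrel : ∀ᵐ ω ∂Q, ∀ n,
      Z (e (d n)) ω + Z (e (d n)) ω = Z (ePos (d n)) ω + Z (eNeg (d n)) ω := by
    rw [ae_all_iff]
    intro n
    have h0 : e (d n) + e (d n) = ePos (d n) + eNeg (d n) := by
      simp only [e, ePos, eNeg, ← WithLp.toLp_add, Prod.mk_add_mk, add_zero, add_neg_cancel]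
    have h1 := hadd (e (d n)) (e (d n))
    rw [h0] at h1
    filter_upwards [h1, hadd (ePos (d n)) (eNeg (d n))] with ω h1 h2
    rw [h1] at h2
    exact h2
  have hb : ∀ᵐ ω ∂Q, ∃ C : ℝ, ∀ n, ‖Z (e (d n)) ω‖ ≤ C := by
    filter_upwards [hpos, hneg, hrel] with ω ⟨C₁, h1⟩ ⟨C₂, h2⟩ h3
    refine ⟨C₁ + C₂, fun n => ?_⟩
    have h4 : ‖Z (e (d n)) ω + Z (e (d n)) ω‖ ≤ C₁ + C₂ := by
      rw [h3]
      exact (norm_add_le _ _).trans (add_le_add (h1 n) (h2 n))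
    rw [← two_mul, norm_mul, Complex.norm_ofNat] at h4
    linarith [norm_nonneg (Z (e (d n)) ω)]
  have he : Continuous e := by
    have : Continuous a := (ContinuousMap.toLp (E := ℂ) 2 μ ℂ).continuous.comp (circleTranslate f).continuous
    fun_prop
  obtain ⟨Y, hY, hYb⟩ := exists_modification_bounded (Y := fun t => Z (e t)) hd
    (fun t => (hZ.memLp_two (e t)).1) (fun t => by
      simp only [eLpNorm_sub_complex_isonormal hZ hadd]
      rw [← ENNReal.ofReal_zero]
      refine ENNReal.tendsto_ofReal ?_
      exact tendsto_iff_norm_sub_tendsto_zero.1 (he.tendsto t)) hb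
  refine ⟨Ω', mΩ', Q, Y, hQ, ?_, hYb⟩
  convert (hZ.comp_right e).congr hY using 1
  ext t s
  rw [← inner_toLp_circleTranslate]
  simp [e, a, WithLp.prod_inner_apply]

/-! ### Spectral measures of fractional noise as images of weights on the line. -/

/-- The image on the circle of the measure `(1 - cos (2πx)) q(x) dx` on the line. -/
noncomputable def periodization (q : ℝ → ℝ) : Measure UnitAddCircle :=
  (volume.withDensity fun x : ℝ => ENNReal.ofReal ((1 - Real.cos (2 * Real.pi * x)) * q x)).map
    (fun x : ℝ => (x : UnitAddCircle))

theorem measurable_coe_unitAddCircle : Measurable fun x : ℝ => (x : UnitAddCircle) :=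
  (AddCircle.continuous_mk' 1).measurable

/-- `q` is an even weight for which `∫ (1 - cos (2πnx)) q(x) dx = D |n|^(2H)`. -/
structure IsFgnWeight (H D : ℝ) (q : ℝ → ℝ) : Prop where
  measurable : Measurable q
  nonneg : ∀ x, 0 ≤ q x
  even : ∀ x, q (-x) = q x
  integrable : ∀ n : ℤ, Integrable fun x : ℝ => (1 - Real.cos (2 * Real.pi * n * x)) * q x
  integral_eq : ∀ n : ℤ, ∫ x : ℝ, (1 - Real.cos (2 * Real.pi * n * x)) * q x = D * absPow H n
  pos : 0 < D

theorem IsFgnWeight.isFiniteMeasure {H D : ℝ} {q : ℝ → ℝ} (hq : IsFgnWeight H D q) :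
    IsFiniteMeasure (periodization q) := by
  have h := hq.integrable 1
  simp only [Int.cast_one, mul_one] at h
  have := isFiniteMeasure_withDensity_ofReal h.2
  unfold periodization
  infer_instance

/-- With θ = 2πx, (1 - cos θ) cos kθ = ½(1 - cos (k+1)θ) + ½(1 - cos (k-1)θ) - (1 - cos kθ), which
reproduces the second difference in `fgnCov`. The imaginary part is odd and integrates to 0. -/
theorem IsFgnWeight.integral_fourier {H D : ℝ} {q : ℝ → ℝ} (hq : IsFgnWeight H D q) (k : ℤ) :
    ∫ t, fourier k t ∂(periodization q) = ((D * fgnCov H k : ℝ) : ℂ) := by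
  have hm := hq.measurable
  rw [periodization, integral_map measurable_coe_unitAddCircle.aemeasurable
      (by exact (ContinuousMap.continuous _).aestronglyMeasurable),
    integral_withDensity_eq_integral_toReal_smul (by fun_prop) (by simp)]
  have e (x : ℝ) : (ENNReal.ofReal ((1 - Real.cos (2 * Real.pi * x)) * q x)).toReal •
      fourier k (x : UnitAddCircle) =
      (((1 - Real.cos (2 * Real.pi * (k + 1 : ℤ) * x)) * q x / 2
        + (1 - Real.cos (2 * Real.pi * (k - 1 : ℤ) * x)) * q x / 2
        - (1 - Real.cos (2 * Real.pi * k * x)) * q x : ℝ) : ℂ)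
      + ((Real.sin (2 * Real.pi * k * x) * ((1 - Real.cos (2 * Real.pi * x)) * q x) : ℝ) : ℂ)
        * Complex.I := by
    rw [ENNReal.toReal_ofReal (mul_nonneg (by linarith [Real.cos_le_one (2 * Real.pi * x)])
      (hq.nonneg x)), fourier_coe_apply]
    have e1 : 2 * (Real.pi : ℂ) * Complex.I * k * x / (1 : ℝ)
        = ((2 * Real.pi * k * x : ℝ) : ℂ) * Complex.I := by
      push_cast
      ring
    rw [e1, Complex.exp_mul_I, ← Complex.ofReal_cos, ← Complex.ofReal_sin]
    have e2 : 2 * Real.pi * ((k + 1 : ℤ) : ℝ) * x = 2 * Real.pi * k * x + 2 * Real.pi * x := by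
      push_cast; ring
    have e3 : 2 * Real.pi * ((k - 1 : ℤ) : ℝ) * x = 2 * Real.pi * k * x - 2 * Real.pi * x := by
      push_cast; ring
    rw [e2, e3, Real.cos_add, Real.cos_sub, Complex.real_smul]
    push_cast
    ring
  simp only [e]
  have i1 := (hq.integrable (k + 1)).div_const 2
  have i2 := (hq.integrable (k - 1)).div_const 2
  have i3 := hq.integrable k
  have i4 : Integrable fun x : ℝ =>
      Real.sin (2 * Real.pi * k * x) * ((1 - Real.cos (2 * Real.pi * x)) * q x) := by
    have h := hq.integrable 1
    simp only [Int.cast_one, mul_one] at h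
    refine h.bdd_mul (c := 1) (by fun_prop) (Filter.Eventually.of_forall fun x => ?_)
    exact Real.abs_sin_le_one _
  have hodd : ∫ x : ℝ, Real.sin (2 * Real.pi * k * x) * ((1 - Real.cos (2 * Real.pi * x)) * q x)
      = 0 := by
    have := integral_neg_eq_self (fun x : ℝ =>
      Real.sin (2 * Real.pi * k * x) * ((1 - Real.cos (2 * Real.pi * x)) * q x)) volume
    simp only [mul_neg, Real.sin_neg, Real.cos_neg, hq.even, neg_mul, integral_neg] at this
    linarith
  rw [integral_add ((i1.add i2).sub i3).ofReal (i4.ofReal.mul_const _), integral_mul_const,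
    integral_complex_ofReal, integral_complex_ofReal, hodd]
  have hs := integral_sub (i1.add i2) i3
  simp only [Pi.add_apply] at hs
  rw [hs, integral_add i1 i2, integral_div, integral_div, hq.integral_eq, hq.integral_eq, hq.integral_eq]
  rw [Complex.ofReal_zero, zero_mul, add_zero, fgnCov]
  congr 1
  ring

theorem fgnCov_zero (H : ℝ) : fgnCov H 0 = 1 := by
  norm_num [fgnCov, absPow]

/-- The normalized periodization is a probability measure with Fourier coefficients `fgnCov H`. -/
theorem IsFgnWeight.exists_probabilityMeasure {H D : ℝ} {q : ℝ → ℝ} (hq : IsFgnWeight H D q) :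
    IsProbabilityMeasure (Real.toNNReal D⁻¹ • periodization q) ∧
    ∀ k : ℤ, ∫ t, fourier k t ∂(Real.toNNReal D⁻¹ • periodization q) = (fgnCov H k : ℂ) := by
  have := hq.isFiniteMeasure
  have hD := hq.pos
  have h (k : ℤ) : ∫ t, fourier k t ∂(Real.toNNReal D⁻¹ • periodization q) = (fgnCov H k : ℂ) := by
    rw [integral_smul_nnreal_measure, hq.integral_fourier, NNReal.smul_def,
      Real.coe_toNNReal _ (inv_nonneg.2 hD.le), Complex.real_smul, ← Complex.ofReal_mul,
      inv_mul_cancel_left₀ hD.ne']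
  refine ⟨⟨?_⟩, h⟩
  have h0 := h 0
  simp only [fourier_zero, fgnCov_zero, integral_const] at h0
  have h1 : (Real.toNNReal D⁻¹ • periodization q).real Set.univ = 1 := by
    exact Complex.ofReal_injective (by simpa using h0)
  rw [measureReal_def] at h1
  exact (ENNReal.toReal_eq_one_iff _).1 h1

/-- The null point 0 has to be excluded: a negative real power of 0 is 0 by convention, so the
indicator of [-1, 1] exceeds the power weight there. -/
theorem periodization_mono {q q' : ℝ → ℝ} (h : ∀ x, x ≠ 0 → q x ≤ q' x) :
    periodization q ≤ periodization q' := by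
  refine Measure.map_mono (withDensity_mono ?_) measurable_coe_unitAddCircle
  have : ∀ᵐ x : ℝ, x ≠ 0 := by
    rw [ae_iff]; simp
  filter_upwards [this] with x hx
  exact ENNReal.ofReal_le_ofReal (mul_le_mul_of_nonneg_left (h x hx)
    (by linarith [Real.cos_le_one (2 * Real.pi * x)]))

theorem periodization_apply {q : ℝ → ℝ} {A : Set UnitAddCircle}
    (hA : MeasurableSet A) :
    periodization q A = ∫⁻ x : ℝ, A.indicator 1 (x : UnitAddCircle) *
      ENNReal.ofReal (1 - Real.cos (2 * Real.pi * x)) * ENNReal.ofReal (q x) := by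
  have hA' := measurable_coe_unitAddCircle hA
  rw [periodization, Measure.map_apply measurable_coe_unitAddCircle hA, withDensity_apply _ hA',
    ← lintegral_indicator hA']
  refine lintegral_congr fun x => ?_
  by_cases hx : (x : UnitAddCircle) ∈ A
  · rw [Set.indicator_of_mem (show x ∈ (fun x : ℝ => (x : UnitAddCircle)) ⁻¹' A from hx),
      Set.indicator_of_mem hx, Pi.one_apply, one_mul,
      ENNReal.ofReal_mul (by linarith [Real.cos_le_one (2 * Real.pi * x)])]
  · rw [Set.indicator_of_notMem (show x ∉ (fun x : ℝ => (x : UnitAddCircle)) ⁻¹' A from hx),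
      Set.indicator_of_notMem hx, zero_mul, zero_mul]

theorem periodization_add_le {q q' : ℝ → ℝ} (hq : Measurable q) :
    periodization (fun x => q x + q' x) ≤ periodization q + periodization q' := by
  refine Measure.le_iff.2 fun A hA => ?_
  rw [Measure.add_apply, periodization_apply hA, periodization_apply hA, periodization_apply hA,
    ← lintegral_add_left]
  · refine lintegral_mono fun x => ?_
    dsimp only
    rw [← mul_add]
    gcongr
    exact ENNReal.ofReal_add_le
  · have : Measurable fun x : ℝ => A.indicator (1 : UnitAddCircle → ENNReal) (x : UnitAddCircle) :=
      (measurable_one.indicator hA).comp measurable_coe_unitAddCircle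
    fun_prop

theorem lintegral_Ioc_int_of_periodic {F : ℝ → ENNReal} (hF : ∀ (n : ℤ) x, F (x + n) = F x)
    (n : ℤ) : ∫⁻ x in Set.Ioc (n : ℝ) (n + 1), F x = ∫⁻ x in Set.Ioc (0 : ℝ) 1, F x := by
  rw [← lintegral_indicator measurableSet_Ioc, ← lintegral_indicator measurableSet_Ioc,
    ← lintegral_add_right_eq_self _ (n : ℝ)]
  refine lintegral_congr fun x => ?_
  simp only [Set.indicator_apply, hF, Set.mem_Ioc]
  congr 1
  refine propext ⟨fun h => ⟨?_, ?_⟩, fun h => ⟨?_, ?_⟩⟩ <;> linarith [h.1, h.2]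

/-- The part of a weight away from the origin is dominated, after periodization, by a
multiple of the indicator of `[-1, 1]`. -/
theorem exists_periodization_tail_le {a : ℝ} (ha : 1 < a) :
    ∃ c : NNReal, periodization (fun x => if |x| ≤ 1 then 0 else |x| ^ (-a)) ≤
      c • periodization (fun x => if |x| ≤ 1 then 1 else 0) := by
  -- If n < x ≤ n + 1 and |x| > 1, then |n| ≤ |x| + 1 ≤ 2|x|, so |x|^{-a} ≤ (|n|/2)^{-a} = `b n`.
  -- For n = 0 the tail weight vanishes on the interval.
  let b : ℤ → ℝ := fun n => 2 ^ a * |(n : ℝ)| ^ (-a)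
  have hb : Summable b := (Real.summable_abs_int_rpow ha).mul_left _
  have hb0 (n : ℤ) : 0 ≤ b n := by positivity
  refine ⟨(∑' n, b n).toNNReal, Measure.le_iff.2 fun A hA => ?_⟩
  rw [Measure.smul_apply, periodization_apply hA, periodization_apply hA]
  set F : ℝ → ENNReal := fun x => A.indicator 1 (x : UnitAddCircle) *
      ENNReal.ofReal (1 - Real.cos (2 * Real.pi * x)) with hF
  have hper (n : ℤ) (x : ℝ) : F (x + n) = F x := by
    have h1 : ((x + n : ℝ) : UnitAddCircle) = x := by
      rw [AddCircle.coe_add, add_eq_left, AddCircle.coe_eq_zero_iff]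
      exact ⟨n, by simp⟩
    have h2 : Real.cos (2 * Real.pi * (x + n)) = Real.cos (2 * Real.pi * x) := by
      rw [← Real.cos_add_int_mul_two_pi (2 * Real.pi * x) n]; ring_nf
    simp only [hF, h1, h2]
  have hlow : ∫⁻ x in Set.Ioc (0 : ℝ) 1, F x ≤
      ∫⁻ x : ℝ, F x * ENNReal.ofReal (if |x| ≤ 1 then 1 else 0) := by
    rw [← lintegral_indicator measurableSet_Ioc]
    refine lintegral_mono fun x => ?_
    by_cases hx : x ∈ Set.Ioc (0 : ℝ) 1
    · rw [Set.indicator_of_mem hx, if_pos (by rw [abs_of_pos hx.1]; exact hx.2),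
        ENNReal.ofReal_one, mul_one]
    · rw [Set.indicator_of_notMem hx]
      exact zero_le
  calc ∫⁻ x : ℝ, F x * ENNReal.ofReal (if |x| ≤ 1 then 0 else |x| ^ (-a))
      = ∑' n : ℤ, ∫⁻ x in Set.Ioc (n : ℝ) (n + 1),
          F x * ENNReal.ofReal (if |x| ≤ 1 then 0 else |x| ^ (-a)) := by
        rw [← lintegral_iUnion (fun _ => measurableSet_Ioc) (Set.pairwise_disjoint_Ioc_intCast ℝ),
          iUnion_Ioc_intCast, Measure.restrict_univ]
    _ ≤ ∑' n : ℤ, ENNReal.ofReal (b n) * ∫⁻ x in Set.Ioc (0 : ℝ) 1, F x := by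
        refine ENNReal.tsum_le_tsum fun n => ?_
        rw [← lintegral_Ioc_int_of_periodic hper n, ← lintegral_const_mul' _ _ ENNReal.ofReal_ne_top]
        refine setLIntegral_mono' measurableSet_Ioc fun x hx => ?_
        rw [mul_comm]
        gcongr
        split_ifs with h
        · exact hb0 n
        · push Not at h
          have hn : (n : ℝ) ≠ 0 := by
            intro h0
            rw [h0] at hx
            rw [abs_of_pos hx.1] at h
            linarith [hx.2]
          have hn1 : |(n : ℝ)| ≤ 2 * |x| := by
            rw [abs_le]
            constructor <;> cases abs_cases x <;> linarith [hx.1, hx.2]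
          have hx0 : 0 < |x| := by linarith
          calc |x| ^ (-a) ≤ (|(n : ℝ)| / 2) ^ (-a) := by
                refine Real.rpow_le_rpow_of_nonpos (by positivity) (by linarith) (by linarith)
            _ = b n := by
                simp only [b]
                rw [Real.div_rpow (abs_nonneg _) (by norm_num), Real.rpow_neg (by norm_num : (0:ℝ) ≤ 2)]
                field_simp
    _ = (∑' n, b n).toNNReal • ∫⁻ x in Set.Ioc (0 : ℝ) 1, F x := by
        rw [ENNReal.tsum_mul_right, ← ENNReal.ofReal_tsum_of_nonneg hb0 hb]
        rfl
    _ ≤ _ := by gcongr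

/-- The power weight would be 1/|x|, for which the integral diverges at infinity. Over the two
periods in [-1, 1] the cosine integrates to 0 when n ≠ 0, leaving the length 2. -/
theorem isFgnWeight_zero : IsFgnWeight 0 2 (fun x => if |x| ≤ 1 then 1 else 0) := by
  have hset (x : ℝ) : |x| ≤ 1 ↔ x ∈ Set.Icc (-1 : ℝ) 1 := by rw [Set.mem_Icc, abs_le]
  have e (n : ℤ) : (fun x : ℝ => (1 - Real.cos (2 * Real.pi * n * x)) * if |x| ≤ 1 then 1 else 0)
      = (Set.Icc (-1 : ℝ) 1).indicator fun x => 1 - Real.cos (2 * Real.pi * n * x) := by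
    ext x
    simp only [hset, Set.indicator_apply, mul_ite, mul_one, mul_zero]
  refine ⟨?_, fun x => ?_, fun x => ?_, fun n => ?_, fun n => ?_, two_pos⟩
  · exact Measurable.ite (measurableSet_le (by fun_prop) measurable_const) measurable_const
      measurable_const
  · split_ifs <;> norm_num
  · simp only [abs_neg]
  · rw [e, integrable_indicator_iff measurableSet_Icc]
    exact Continuous.integrableOn_Icc (by fun_prop)
  · rw [e, integral_indicator measurableSet_Icc, integral_Icc_eq_integral_Ioc,
      ← intervalIntegral.integral_of_le (by norm_num), absPow]
    split_ifs with hn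
    · simp [hn]
    · have hn' : 2 * Real.pi * n ≠ 0 := by
        have := Real.pi_ne_zero
        have : (n : ℝ) ≠ 0 := Int.cast_ne_zero.2 hn
        positivity
      rw [intervalIntegral.integral_sub (by simp)
        (Continuous.intervalIntegrable (by fun_prop) _ _),
        intervalIntegral.integral_comp_mul_left (fun x => Real.cos x) hn', integral_cos]
      have : Real.sin (2 * Real.pi * n) = 0 := by
        have := Real.sin_int_mul_pi (2 * n)
        push_cast at this
        rw [← this]; ring_nf
      simp [this]
      norm_num

/-- Near 0, 1 - cos y ≤ y²/2 gives a multiple of x^{1-2H}, integrable because H < 1; at infinity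
2x^{-2H-1} is integrable because H > 0. -/
theorem integrable_one_sub_cos_mul_rpow {H : ℝ} (h0 : 0 < H) (h1 : H < 1) :
    Integrable fun x : ℝ => (1 - Real.cos (2 * Real.pi * x)) * |x| ^ (-(2 * H + 1)) := by
  have hmeas : Measurable fun x : ℝ =>
      (1 - Real.cos (2 * Real.pi * x)) * |x| ^ (-(2 * H + 1)) := by fun_prop
  have hIoi : IntegrableOn (fun x : ℝ =>
      (1 - Real.cos (2 * Real.pi * x)) * |x| ^ (-(2 * H + 1))) (Set.Ioi 0) := by
    rw [← Set.Ioc_union_Ioi_eq_Ioi zero_le_one]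
    refine IntegrableOn.union ?_ ?_
    · have hb : IntegrableOn (fun x : ℝ => (2 * Real.pi) ^ 2 / 2 * x ^ (1 - 2 * H)) (Set.Ioc 0 1) :=
        ((intervalIntegrable_iff_integrableOn_Ioc_of_le zero_le_one).1
          (intervalIntegral.intervalIntegrable_rpow' (by linarith))).const_mul _
      refine Integrable.mono' hb hmeas.aestronglyMeasurable ?_
      refine (ae_restrict_iff' measurableSet_Ioc).2 (Filter.Eventually.of_forall fun x hx => ?_)
      have hx0 : 0 < x := hx.1
      have hc := Real.one_sub_sq_div_two_le_cos (x := 2 * Real.pi * x)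
      have hc' := Real.cos_le_one (2 * Real.pi * x)
      rw [abs_of_pos hx0, Real.norm_of_nonneg
        (mul_nonneg (by linarith) (Real.rpow_nonneg hx0.le _))]
      have : x ^ (1 - 2 * H) = x ^ 2 * x ^ (-(2 * H + 1)) := by
        rw [← Real.rpow_natCast x 2, ← Real.rpow_add hx0]
        congr 1
        push_cast
        ring
      rw [this, ← mul_assoc]
      refine mul_le_mul_of_nonneg_right ?_ (Real.rpow_nonneg hx0.le _)
      linarith [mul_pow (2 * Real.pi) x 2]
    · have hb : IntegrableOn (fun x : ℝ => 2 * x ^ (-(2 * H + 1))) (Set.Ioi 1) :=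
        (integrableOn_Ioi_rpow_of_lt (by linarith) one_pos).const_mul _
      refine Integrable.mono' hb hmeas.aestronglyMeasurable ?_
      refine (ae_restrict_iff' measurableSet_Ioi).2 (Filter.Eventually.of_forall fun x hx => ?_)
      have hx0 : 0 < x := one_pos.trans hx
      have hc := Real.neg_one_le_cos (2 * Real.pi * x)
      have hc' := Real.cos_le_one (2 * Real.pi * x)
      rw [abs_of_pos hx0, Real.norm_of_nonneg
        (mul_nonneg (by linarith) (Real.rpow_nonneg hx0.le _))]
      exact mul_le_mul_of_nonneg_right (by linarith) (Real.rpow_nonneg hx0.le _)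
  have hIic : IntegrableOn (fun x : ℝ =>
      (1 - Real.cos (2 * Real.pi * x)) * |x| ^ (-(2 * H + 1))) (Set.Iic 0) := by
    rw [← Measure.map_neg_eq_self (volume : Measure ℝ)]
    have m : MeasurableEmbedding fun x : ℝ => -x := (Homeomorph.neg ℝ).measurableEmbedding
    rw [m.integrableOn_map_iff]
    simp_rw [Function.comp_def, abs_neg, mul_neg, Real.cos_neg, Set.neg_preimage, Set.neg_Iic,
      neg_zero]
    exact Iff.mpr integrableOn_Ici_iff_integrableOn_Ioi hIoi
  rw [← integrableOn_univ, ← Set.Iic_union_Ioi (a := (0 : ℝ))]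
  exact hIic.union hIoi

/-- D is the integral for n = 1. Substituting nx for x produces |n|^{2H+1} from the weight and
|n|^{-1} from dx. -/
theorem exists_isFgnWeight_rpow {H : ℝ} (h0 : 0 < H) (h1 : H < 1) :
    ∃ D, IsFgnWeight H D (fun x => |x| ^ (-(2 * H + 1))) := by
  let g : ℝ → ℝ := fun x => (1 - Real.cos (2 * Real.pi * x)) * |x| ^ (-(2 * H + 1))
  have hg : Integrable g := integrable_one_sub_cos_mul_rpow h0 h1
  have hg0 (x : ℝ) : 0 ≤ g x :=
    mul_nonneg (by linarith [Real.cos_le_one (2 * Real.pi * x)]) (by positivity)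
  have hscale (n : ℤ) (hn : n ≠ 0) (x : ℝ) :
      (1 - Real.cos (2 * Real.pi * n * x)) * |x| ^ (-(2 * H + 1))
        = |(n : ℝ)| ^ (2 * H + 1) * g (n * x) := by
    have hn' : 0 < |(n : ℝ)| := abs_pos.2 (Int.cast_ne_zero.2 hn)
    simp only [g]
    rw [abs_mul, Real.mul_rpow (abs_nonneg _) (abs_nonneg _), Real.rpow_neg (abs_nonneg (n : ℝ)),
      mul_assoc (2 * Real.pi)]
    have := (Real.rpow_pos_of_pos hn' (2 * H + 1)).ne'
    field_simp
  refine ⟨∫ x, g x, by fun_prop, fun x => by positivity, fun x => by simp only [abs_neg],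
    fun n => ?_, fun n => ?_, ?_⟩
  · by_cases hn : n = 0
    · simp [hn]
    · simp only [hscale n hn]
      exact (hg.comp_mul_left' (Int.cast_ne_zero.2 hn)).const_mul _
  · by_cases hn : n = 0
    · simp [hn, absPow]
    · simp only [hscale n hn]
      have hn' : 0 < |(n : ℝ)| := abs_pos.2 (Int.cast_ne_zero.2 hn)
      rw [integral_const_mul, Measure.integral_comp_mul_left g, absPow, if_neg hn,
        Real.rpow_add hn', Real.rpow_one, abs_inv, smul_eq_mul]
      field_simp
  · rw [integral_pos_iff_support_of_nonneg hg0 hg]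
    have hsub : Set.Ioo (0 : ℝ) 1 ⊆ Function.support g := by
      intro x hx
      have hcos : Real.cos (2 * Real.pi * x) ≠ 1 := by
        intro h
        rw [Real.cos_eq_one_iff] at h
        obtain ⟨n, hn⟩ := h
        have hxn : (n : ℝ) = x := by
          have := Real.two_pi_pos.ne'
          field_simp at hn
          linarith
        rw [← hxn] at hx
        have a1 : (0 : ℤ) < n := by exact_mod_cast hx.1
        have a2 : n < (1 : ℤ) := by exact_mod_cast hx.2
        omega
      exact mul_ne_zero (sub_ne_zero.2 hcos.symm)
        (Real.rpow_pos_of_pos (abs_pos.2 hx.1.ne') _).ne'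
    exact lt_of_lt_of_le (by simp) (measure_mono hsub)

/-! ### Uniqueness and domination of spectral measures, and the conclusion. -/

/-- A finite measure on the circle is determined by its Fourier coefficients. -/
theorem measure_ext_of_integral_fourier {μ ν : Measure UnitAddCircle} [IsFiniteMeasure μ]
    [IsFiniteMeasure ν] (h : ∀ n : ℤ, ∫ t, fourier n t ∂μ = ∫ t, fourier n t ∂ν) : μ = ν := by
  have hint (ρ : Measure UnitAddCircle) [IsFiniteMeasure ρ] (f : C(UnitAddCircle, ℂ)) :
      Integrable f ρ :=
    f.continuous.integrable_of_hasCompactSupport (HasCompactSupport.of_compactSpace _)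
  have hcont (ρ : Measure UnitAddCircle) [IsFiniteMeasure ρ] :
      Continuous fun f : C(UnitAddCircle, ℂ) => ∫ t, f t ∂ρ := by
    refine (LipschitzWith.of_dist_le_mul (K := (ρ.real Set.univ).toNNReal) fun f g => ?_).continuous
    rw [dist_eq_norm, dist_eq_norm, ← integral_sub (hint ρ f) (hint ρ g),
      Real.coe_toNNReal _ measureReal_nonneg, mul_comm]
    exact norm_integral_le_of_norm_le_const
      (Filter.Eventually.of_forall fun t => (f - g).norm_coe_le_norm t)
  have hall (f : C(UnitAddCircle, ℂ)) : ∫ t, f t ∂μ = ∫ t, f t ∂ν := by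
    have hcl : IsClosed {f : C(UnitAddCircle, ℂ) | ∫ t, f t ∂μ = ∫ t, f t ∂ν} :=
      isClosed_eq (hcont μ) (hcont ν)
    have hspan : (Submodule.span ℂ (Set.range (@fourier 1)) : Set C(UnitAddCircle, ℂ)) ⊆
        {f : C(UnitAddCircle, ℂ) | ∫ t, f t ∂μ = ∫ t, f t ∂ν} := by
      intro f hf
      refine Submodule.span_induction ?_ ?_ ?_ ?_ hf
      · rintro _ ⟨n, rfl⟩
        exact h n
      · simp
      · intro f g _ _ hf hg
        simp only [Set.mem_ofPred_eq, ContinuousMap.add_apply] at *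
        rw [integral_add (hint μ f) (hint μ g), integral_add (hint ν f) (hint ν g), hf, hg]
      · intro c f _ hf
        simp only [Set.mem_ofPred_eq, ContinuousMap.smul_apply] at *
        rw [integral_smul, integral_smul, hf]
    have hdense := span_fourier_closure_eq_top (T := 1)
    have hf : f ∈ (Submodule.span ℂ (Set.range (@fourier 1))).topologicalClosure := by
      rw [hdense]; trivial
    exact hcl.closure_subset_iff.2 hspan hf
  refine ext_of_forall_integral_eq_of_IsFiniteMeasure fun f => ?_
  have := hall ⟨fun t => (f t : ℂ), by fun_prop⟩
  simp only [ContinuousMap.coe_mk, integral_complex_ofReal] at this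
  exact Complex.ofReal_injective this

theorem Measure.nnreal_smul_le_nnreal_smul {α : Type*} [MeasurableSpace α] {μ ν : Measure α}
    (c : NNReal) (h : μ ≤ ν) : c • μ ≤ c • ν := by
  intro s
  rw [Measure.smul_apply, Measure.smul_apply]
  exact mul_le_mul_right (h s) _

/-- For `H₁ < H₂` the spectral measure of index `H₁` is dominated by that of index `H₂`. -/
theorem exists_dominated_spectral_measures {H₁ H₂ : ℝ} (h₀ : 0 ≤ H₁) (h₁₂ : H₁ < H₂)
    (h₂ : H₂ < 1) :
    ∃ (μ₁ μ₂ : Measure UnitAddCircle) (c : NNReal),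
      IsProbabilityMeasure μ₁ ∧ IsProbabilityMeasure μ₂ ∧
      (∀ k : ℤ, ∫ t, fourier k t ∂μ₁ = (fgnCov H₁ k : ℂ)) ∧
      (∀ k : ℤ, ∫ t, fourier k t ∂μ₂ = (fgnCov H₂ k : ℂ)) ∧ μ₁ ≤ c • μ₂ := by
  obtain ⟨D₂, hq₂⟩ := exists_isFgnWeight_rpow (h₀.trans_lt h₁₂) h₂
  suffices ∃ (D₁ : ℝ) (q₁ : ℝ → ℝ) (c : NNReal), IsFgnWeight H₁ D₁ q₁ ∧
      periodization q₁ ≤ c • periodization fun x => |x| ^ (-(2 * H₂ + 1)) by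
    obtain ⟨D₁, q₁, c, hq₁, hle⟩ := this
    obtain ⟨hp₁, hc₁⟩ := hq₁.exists_probabilityMeasure
    obtain ⟨hp₂, hc₂⟩ := hq₂.exists_probabilityMeasure
    -- `D₂` undoes the normalisation of the dominating measure and `D₁⁻¹` normalises the dominated
    -- one.
    refine ⟨_, _, D₁⁻¹.toNNReal * (c * D₂.toNNReal), hp₁, hp₂, hc₁, hc₂, ?_⟩
    have hDD : D₂.toNNReal * D₂⁻¹.toNNReal = 1 := by
      rw [← Real.toNNReal_mul hq₂.pos.le, mul_inv_cancel₀ hq₂.pos.ne', Real.toNNReal_one]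
    rw [smul_smul, mul_assoc, mul_assoc, hDD, mul_one, mul_smul]
    exact Measure.nnreal_smul_le_nnreal_smul _ hle
  have hsmall : periodization (fun x => if |x| ≤ 1 then 1 else 0) ≤
      periodization fun x => |x| ^ (-(2 * H₂ + 1)) := by
    refine periodization_mono fun x hx => ?_
    split_ifs with h
    · exact Real.one_le_rpow_of_pos_of_le_one_of_nonpos (abs_pos.2 hx) h (by linarith)
    · positivity
  rcases h₀.eq_or_lt with rfl | h₀'
  · exact ⟨2, _, 1, isFgnWeight_zero, by rwa [one_smul]⟩
  · obtain ⟨D₁, hq₁⟩ := exists_isFgnWeight_rpow h₀' (h₁₂.trans h₂)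
    obtain ⟨c, hc⟩ := exists_periodization_tail_le (a := 2 * H₁ + 1) (by linarith)
    -- The 1 accounts for |x| ≤ 1, where the larger exponent gives the larger weight, and `c` for
    -- the tail folded back onto [-1, 1].
    refine ⟨D₁, _, 1 + c, hq₁, ?_⟩
    calc periodization (fun x => |x| ^ (-(2 * H₁ + 1)))
        ≤ periodization (fun x => |x| ^ (-(2 * H₂ + 1)) +
            if |x| ≤ 1 then 0 else |x| ^ (-(2 * H₁ + 1))) := by
          refine periodization_mono fun x hx => ?_
          split_ifs with h
          · rw [add_zero]
            exact Real.rpow_le_rpow_of_exponent_ge (abs_pos.2 hx) h (by linarith)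
          · exact le_add_of_nonneg_left (by positivity)
      _ ≤ periodization (fun x => |x| ^ (-(2 * H₂ + 1))) +
            periodization (fun x => if |x| ≤ 1 then 0 else |x| ^ (-(2 * H₁ + 1))) :=
          periodization_add_le (by fun_prop)
      _ ≤ periodization (fun x => |x| ^ (-(2 * H₂ + 1))) +
            c • periodization (fun x => |x| ^ (-(2 * H₂ + 1))) := by
          gcongr
          exact hc.trans (Measure.nnreal_smul_le_nnreal_smul c hsmall)
      _ = _ := by rw [add_smul, one_smul]

/-- A fractional Gaussian noise exists as soon as its covariance has a spectral measure. -/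
theorem exists_fractionalGaussianNoise {H : ℝ} {μ : Measure UnitAddCircle}
    [IsProbabilityMeasure μ] (hμ : ∀ k : ℤ, ∫ t, fourier k t ∂μ = (fgnCov H k : ℂ)) :
    ∃ (Ω : Type) (_ : MeasurableSpace Ω) (P : Measure Ω) (Δ : ℤ → Ω → ℂ),
      IsFractionalGaussianNoise H Δ P := by
  obtain ⟨Ω, mΩ, P, Z, hZ, -⟩ := exists_complex_isonormal (Lp ℂ 2 μ)
  refine ⟨Ω, mΩ, P, fun n => Z (ContinuousMap.toLp (E := ℂ) 2 μ ℂ (fourier n)),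
    hZ.isProbabilityMeasure, ?_⟩
  convert hZ.comp_right fun n : ℤ => ContinuousMap.toLp (E := ℂ) 2 μ ℂ (fourier n) using 1
  ext n m
  rw [ContinuousMap.inner_toLp, ← hμ]
  refine integral_congr_ae (Filter.Eventually.of_forall fun t => ?_)
  simp only
  rw [← fourier_neg, ← fourier_add, sub_eq_add_neg]

theorem IsFractionalGaussianNoise.isSpectralMeasure_iff {Ω : Type} [MeasurableSpace Ω] {H : ℝ}
    {Δ : ℤ → Ω → ℂ} {P : Measure Ω} (hΔ : IsFractionalGaussianNoise H Δ P)
    {μ : Measure UnitAddCircle} :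
    IsSpectralMeasure Δ P μ ↔
      IsProbabilityMeasure μ ∧ ∀ k : ℤ, ∫ t, fourier k t ∂μ = (fgnCov H k : ℂ) := by
  refine and_congr_right fun _ => ⟨fun h k => ?_, fun h n m => ?_⟩
  · have := h k 0
    rw [hΔ.2.covariance_eq, sub_zero] at this
    exact this.symm
  · rw [hΔ.2.covariance_eq, h]

theorem theorem3 (H₁ H₂ : ℝ) (h₀ : 0 ≤ H₁) (h₁₂ : H₁ ≤ H₂) (h₂ : H₂ < 1) :
    fgnPisierClass H₂ ⊆ fgnPisierClass H₁ := by
  -- The domination argument needs a power weight for `H₂`, hence `0 < H₂`, which strict inequality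
  -- guarantees.
  rcases h₁₂.eq_or_lt with rfl | hlt
  · exact subset_rfl
  rintro f ⟨Ω, mΩ, P, Δ, μ, hΔ, hμ, hf⟩
  obtain ⟨hμp, hμc⟩ := hΔ.isSpectralMeasure_iff.1 hμ
  obtain ⟨μ₁, μ₂, c, hp₁, hp₂, hc₁, hc₂, hle⟩ := exists_dominated_spectral_measures h₀ hlt h₂
  -- The class is defined through some spectral measure; uniqueness identifies it with the explicit
  -- one.
  obtain rfl : μ = μ₂ := measure_ext_of_integral_fourier fun n => by rw [hμc, hc₂]
  obtain ⟨Ω₁, mΩ₁, P₁, Δ₁, hΔ₁⟩ := exists_fractionalGaussianNoise hc₁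
  exact ⟨Ω₁, mΩ₁, P₁, Δ₁, μ₁, hΔ₁, hΔ₁.isSpectralMeasure_iff.2 ⟨hp₁, hc₁⟩,
    pisierClass_subset_of_le_smul c hle hf⟩
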